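/- For $x,y\in\mathbb F_2^n$ let $x\cdot y=\sum_i x_iy_i$. A function $F\colon\mathbb F_2^n\to\mathbb F_2^n$ is \emph{plateaued} if for every $v\in\mathbb F_2^n$ there is an integer $\lambda_v\ge 0$ with $\sum_{x\in\mathbb F_2^n}(-1)^{v\cdot F(x)+x\cdot u}\in\{0,\lambda_v,-\lambda_v\}$ for all $u\in\mathbb F_2^n$. It is \emph{3-to-1} if one point of its image has exactly one preimage and every other point of its image has exactly three preimages. Let $\mathcal G_F=\{(x,F(x)):x\in\mathbb F_2^n\}\subseteq(\mathbb F_2^n)^2$, and define the Boolean function $\gamma_F\colon(\mathbb F_2^n)^2\to\mathbb F_2$ by $\gamma_F(p)=1$ if $p\neq 0$ and $\mathcal G_F\cap(p+\mathcal G_F)\neq\emptyset$, and $\gamma_F(p)=0$ otherwise. For $p\in(\mathbb F_2^n)^2\setminus\mathcal G_F$, the \emph{exclude multiplicity} $\operatorname{mult}_{\mathcal G_F}(p)$ is the number of $3$-element subsets $\{x,y,z\}\subseteq\mathcal G_F$ with $x+y+z=p$. \textbf{Proposition.} Let $n\ge 4$ be even and let $F\colon\mathbb F_2^n\to\mathbb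 F_2^n$ be a plateaued 3-to-1 function. Then $\gamma_F$ has no nontrivial linear structure: there are no $\varepsilon\in\mathbb F_2$ and nonzero $p\in(\mathbb F_2^n)^2$ such that $\gamma_F(x)+\gamma_F(x+p)=\varepsilon$ for all $x\in(\mathbb F_2^n)^2$. Moreover, every point of $(\mathbb F_2^n)^2\setminus\mathcal G_F$ has exclude multiplicity $\alpha(n)=\frac{2^n+(-2)^{n/2+1}-2}{6}$ or $\beta(n)=\frac{2^n+(-2)^{n/2}-2}{6}$, and both $\alpha(n)$ and $\beta(n)$ are strictly less than $\frac{2^n-1}{3}$. -/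

import Mathlib

namespace VBF

/-- The vector space `𝔽₂ⁿ`. -/
abbrev F2 (n : ℕ) : Type := Fin n → ZMod 2

/-- The sign `(-1)^t` of a bit `t`. -/
def sign (t : ZMod 2) : ℤ := if t = 0 then 1 else -1

/-- The Walsh transform `W_f(u) = ∑ x, (-1)^(f x + x · u)` of a Boolean function. -/
def walsh {n : ℕ} (f : F2 n → ZMod 2) (u : F2 n) : ℤ :=
  ∑ x : F2 n, sign (f x + x ⬝ᵥ u)

/-- A Boolean function is plateaued if, for some amplitude `l ≥ 0`, its Walsh transform takes
values in `{0, l, -l}`. -/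
def IsPlateauedBoolean {n : ℕ} (f : F2 n → ZMod 2) : Prop :=
  ∃ l : ℕ, ∀ u : F2 n, walsh f u = 0 ∨ walsh f u = (l : ℤ) ∨ walsh f u = -(l : ℤ)

/-- The component function `v · F`. -/
def component {n : ℕ} (F : F2 n → F2 n) (v : F2 n) : F2 n → ZMod 2 :=
  fun x => v ⬝ᵥ F x

/-- A vectorial Boolean function is plateaued if all its components are. -/
def IsPlateaued {n : ℕ} (F : F2 n → F2 n) : Prop :=
  ∀ v : F2 n, IsPlateauedBoolean (component F v)

/-- `F` is 3-to-1: one point has exactly one preimage, and every other point of the image has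
exactly three. -/
def IsThreeToOne {n : ℕ} (F : F2 n → F2 n) : Prop :=
  ∃ y₀ : F2 n, (F ⁻¹' {y₀}).ncard = 1 ∧
    ∀ y ∈ Set.range F, y ≠ y₀ → (F ⁻¹' {y}).ncard = 3

/-- The graph of `F`, a subset of `(𝔽₂ⁿ)²`. -/
def graph {n : ℕ} (F : F2 n → F2 n) : Set (F2 n × F2 n) :=
  {p | p.2 = F p.1}

/-- The exclude multiplicity of `p` with respect to `S`: the number of 3-element subsets of `S`
whose elements sum to `p`. -/
noncomputable def mult {V : Type*} [AddCommGroup V] (S : Set V) (p : V) : ℕ :=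
  {T : Finset V | T.card = 3 ∧ (T : Set V) ⊆ S ∧ ∑ x ∈ T, x = p}.ncard

/-- `δ_S(a) = |S ∩ (a + S)|`. -/
noncomputable def delta {V : Type*} [AddCommGroup V] (S : Set V) (a : V) : ℕ :=
  (S ∩ ((fun x => a + x) '' S)).ncard

open Classical in
/-- `γ_S(a) = 1` if `a ≠ 0` and `δ_S(a) > 0`, and `γ_S(a) = 0` otherwise. -/
noncomputable def gammaSet {V : Type*} [AddCommGroup V] (S : Set V) (a : V) : ZMod 2 :=
  if a ≠ 0 ∧ 0 < delta S a then 1 else 0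

/-- `γ_F`, the function `γ_S` for `S` the graph of `F`. -/
noncomputable def gamma {n : ℕ} (F : F2 n → F2 n) : F2 n × F2 n → ZMod 2 :=
  gammaSet (graph F)

/-- `a` is a (nontrivial) `ε`-valued linear structure of `f`: `a ≠ 0` and the derivative of `f`
in direction `a` is constantly `ε`. -/
def IsLinearStructure {V : Type*} [AddCommGroup V] (f : V → ZMod 2) (ε : ZMod 2) (a : V) : Prop :=
  a ≠ 0 ∧ ∀ x : V, f x + f (x + a) = ε

/-- `α(n) = (2^n + (-2)^(n/2+1) - 2) / 6`, for `n` even. -/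
def alpha (n : ℕ) : ℚ := (2 ^ n + (-2) ^ (n / 2 + 1) - 2) / 6

/-- `β(n) = (2^n + (-2)^(n/2) - 2) / 6`, for `n` even. -/
def beta (n : ℕ) : ℚ := (2 ^ n + (-2) ^ (n / 2) - 2) / 6

end VBF

namespace VBF

open Finset

variable {n m : ℕ}

/-! Write n = 2m, s = (-2)^m, and A(v) = ∑ₓ (-1)^(v·(F x + y₀)), with y₀ the value taken once. Fibre
sizes give A(v) ≡ 1 mod 3, so A(v) ≠ 0; plateauedness and Parseval then give 2^m ∣ A(v). Hence A(v)
= s·t with t ≡ 1 mod 3, which makes (A - s)(A + 2s) nonnegative. The first two moments of A force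
these products to sum to zero over v ≠ 0, so A(v) ∈ {s, -2s} there (`charSum_eq_or`).

Thus A² = 2s² - sA off 0. Carlet's identity expresses the number of solutions of F x + F y +
F(x+y+a) = b through A², hence through one fibre size (`card_triples`). For b = F a only the trivial
solutions remain, so the graph is Sidon; for b ≠ F a the count is six times the multiplicity, and
fibre sizes 0 and 3 give β and α.

By the Sidon property the Walsh transform of γ at (u, v) is 2^n - W_F(u, v)² off the origin. A
linear structure (a, b) restricts its support: this forces ε = 0, then a = 0, and inverting A leaves
a fibre size equal to 1 - s, impossible when 4 ∣ s. -/

lemma sign_zero : sign 0 = 1 := rfl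

lemma sign_one : sign 1 = -1 := rfl

lemma sign_add : ∀ a b : ZMod 2, sign (a + b) = sign a * sign b := by decide

lemma sign_mul_self : ∀ a : ZMod 2, sign a * sign a = 1 := by decide

lemma add_self_F2 (x : F2 n) : x + x = 0 := funext fun i => CharTwo.add_self_eq_zero (x i)

lemma add_eq_iff_F2 {x y z : F2 n} : x + y = z ↔ x = z + y := by
  constructor
  · rintro rfl; rw [add_assoc, add_self_F2, add_zero]
  · rintro rfl; rw [add_assoc, add_self_F2, add_zero]

lemma add_eq_zero_F2 {x y : F2 n} : x + y = 0 ↔ x = y := by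
  rw [add_eq_iff_F2, zero_add]

lemma card_F2 : Fintype.card (F2 n) = 2 ^ n := by simp [F2, ZMod.card]

/-! ### Characters and moments of the Walsh transform. -/

lemma exists_dotProduct_eq_one {x : F2 n} (hx : x ≠ 0) : ∃ u : F2 n, x ⬝ᵥ u = 1 := by
  obtain ⟨i, hi⟩ := Function.ne_iff.1 hx
  refine ⟨Pi.single i 1, ?_⟩
  rw [dotProduct_single, mul_one]
  revert hi
  generalize x i = z
  revert z
  simp only [Pi.zero_apply]
  decide

/-- Orthogonality of characters. -/
lemma sum_sign_dotProduct (x : F2 n) :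
    ∑ u : F2 n, sign (x ⬝ᵥ u) = if x = 0 then 2 ^ n else 0 := by
  split_ifs with h
  · subst h
    simp [sign_zero]
  · obtain ⟨e, he⟩ := exists_dotProduct_eq_one h
    have := Equiv.sum_comp (Equiv.addRight e) (fun u : F2 n => sign (x ⬝ᵥ u))
    simp only [Equiv.coe_addRight, dotProduct_add, he, sign_add, sign_one] at this
    rw [← Finset.sum_mul] at this
    linarith

lemma sum_sign_dotProduct' (x : F2 n) :
    ∑ u : F2 n, sign (u ⬝ᵥ x) = if x = 0 then 2 ^ n else 0 := by
  simp_rw [dotProduct_comm _ x]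
  exact sum_sign_dotProduct x

/-- Fourier inversion. -/
lemma sum_walsh_mul_sign (f : F2 n → ZMod 2) (a : F2 n) :
    ∑ u, walsh f u * sign (a ⬝ᵥ u) = 2 ^ n * sign (f a) := by
  have h : ∀ u x : F2 n, sign (f x + x ⬝ᵥ u) * sign (a ⬝ᵥ u)
      = sign (f x) * sign ((x + a) ⬝ᵥ u) := by
    intro u x
    rw [sign_add, add_dotProduct, sign_add, mul_assoc]
  simp_rw [walsh, Finset.sum_mul, h]
  rw [Finset.sum_comm]
  simp_rw [← Finset.mul_sum, sum_sign_dotProduct, add_eq_zero_F2]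
  simp [mul_comm]

/-- Parseval's identity. -/
lemma sum_walsh_sq (f : F2 n → ZMod 2) : ∑ u, walsh f u ^ 2 = 2 ^ n * 2 ^ n := by
  have h : ∀ u, walsh f u ^ 2 = ∑ x, sign (f x) * (walsh f u * sign (x ⬝ᵥ u)) := by
    intro u
    rw [sq]
    nth_rw 2 [walsh]
    rw [Finset.mul_sum]
    refine Finset.sum_congr rfl fun x _ => ?_
    rw [sign_add]; ring
  simp_rw [h]
  rw [Finset.sum_comm]
  simp_rw [← Finset.mul_sum, sum_walsh_mul_sign, mul_left_comm (sign _), sign_mul_self]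
  simp

/-- The third moment of the Walsh transform. -/
lemma sum_walsh_cube_mul_sign (f : F2 n → ZMod 2) (a : F2 n) :
    ∑ u, walsh f u ^ 3 * sign (a ⬝ᵥ u)
      = 2 ^ n * ∑ x, ∑ y, sign (f x + f y + f (x + y + a)) := by
  have h : ∀ u, walsh f u ^ 3 * sign (a ⬝ᵥ u)
      = ∑ x, ∑ y, sign (f x) * sign (f y) * (walsh f u * sign ((x + y + a) ⬝ᵥ u)) := by
    intro u
    have : walsh f u ^ 3 * sign (a ⬝ᵥ u)
        = (walsh f u * walsh f u) * (walsh f u * sign (a ⬝ᵥ u)) := by ring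
    rw [this]
    nth_rw 1 2 [walsh]
    rw [Finset.sum_mul_sum, Finset.sum_mul]
    refine Finset.sum_congr rfl fun x _ => ?_
    rw [Finset.sum_mul]
    refine Finset.sum_congr rfl fun y _ => ?_
    simp only [sign_add, add_dotProduct]; ring
  simp_rw [h]
  rw [Finset.sum_comm, Finset.mul_sum]
  refine Finset.sum_congr rfl fun x _ => ?_
  rw [Finset.sum_comm, Finset.mul_sum]
  refine Finset.sum_congr rfl fun y _ => ?_
  rw [← Finset.mul_sum, sum_walsh_mul_sign, sign_add, sign_add]
  ring

/-- A plateaued function whose Walsh transform does not vanish at `0` satisfies Carlet's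
identity for its triple sums. -/
lemma IsPlateauedBoolean.sum_sign_triple {f : F2 n → ZMod 2} (hf : IsPlateauedBoolean f)
    (h0 : walsh f 0 ≠ 0) (a : F2 n) :
    ∑ x, ∑ y, sign (f x + f y + f (x + y + a)) = walsh f 0 ^ 2 * sign (f a) := by
  obtain ⟨l, hl⟩ := hf
  have h0' : walsh f 0 ^ 2 = (l : ℤ) ^ 2 := by
    rcases hl 0 with h | h | h
    · exact absurd h h0
    · rw [h]
    · rw [h, neg_sq]
  -- On {0, l, -l} cubing is multiplication by l², so the third moment collapses to Fourier
  -- inversion.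
  have h3 : ∀ u, walsh f u ^ 3 = walsh f 0 ^ 2 * walsh f u := by
    intro u
    rw [h0']
    rcases hl u with h | h | h <;> rw [h] <;> ring
  have := sum_walsh_cube_mul_sign f a
  simp_rw [h3, mul_assoc, ← Finset.mul_sum, sum_walsh_mul_sign] at this
  have h2 : (2 ^ n : ℤ) ≠ 0 := by positivity
  apply mul_left_cancel₀ h2
  rw [← this]; ring

/-- Amplitudes of plateaued functions in even dimension `2 m` are divisible by `2 ^ m`. -/
lemma IsPlateauedBoolean.two_pow_dvd_walsh_zero {f : F2 (m + m) → ZMod 2}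
    (hf : IsPlateauedBoolean f) (h0 : walsh f 0 ≠ 0) : (2 ^ m : ℤ) ∣ walsh f 0 := by
  obtain ⟨l, hl⟩ := hf
  have hz : walsh f 0 = l ∨ walsh f 0 = -l := (hl 0).resolve_left h0
  have hsq : ∀ u, walsh f u ^ 2 = if walsh f u ≠ 0 then (l : ℤ) ^ 2 else 0 := by
    intro u
    split_ifs with h
    · rcases (hl u).resolve_left h with h | h <;> rw [h]
      ring
    · rw [not_not.1 h]; rfl
  have hP := sum_walsh_sq f
  simp_rw [hsq] at hP
  rw [← Finset.sum_filter, Finset.sum_const, nsmul_eq_mul] at hP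
  set c := #{u | walsh f u ≠ 0} with hc
  have hcle : c ≤ 2 ^ (m + m) := by
    rw [← card_F2]; exact Finset.card_le_univ _
  -- Parseval makes l a power of 2; since at most 2^(2m) Walsh values are nonzero, l is at least
  -- 2^m.
  have hN : c * l ^ 2 = 2 ^ (m + m) * 2 ^ (m + m) := by exact_mod_cast hP
  have hdvd : l ∣ 2 ^ (m + m + (m + m)) := by
    rw [pow_add, ← hN, sq]; exact ⟨c * l, by ring⟩
  obtain ⟨k, -, hk⟩ := (Nat.dvd_prime_pow Nat.prime_two).1 hdvd
  have hmk : m ≤ k := by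
    by_contra! hlt
    have h1 : l ^ 2 < 2 ^ (m + m) := by
      rw [hk, ← pow_mul]; exact Nat.pow_lt_pow_right (by norm_num) (by omega)
    have h2 : c * l ^ 2 < 2 ^ (m + m) * 2 ^ (m + m) :=
      lt_of_le_of_lt (Nat.mul_le_mul_right _ hcle) (Nat.mul_lt_mul_of_pos_left h1 (by positivity))
    omega
  have : (2 ^ m : ℤ) ∣ l := by
    rw [hk]; push_cast; exact pow_dvd_pow _ hmk
  rcases hz with h | h <;> rw [h]
  · exact this
  · exact this.neg_right

/-! ### Fibre sizes and their character sums. -/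

/-- The number of preimages of `y` under `F`. -/
def fiberCard (F : F2 n → F2 n) (y : F2 n) : ℕ := #{x | F x = y}

lemma ncard_preimage_singleton (F : F2 n → F2 n) (y : F2 n) :
    (F ⁻¹' {y}).ncard = fiberCard F y := by
  rw [fiberCard, ← Set.ncard_coe_finset]; congr 1; ext; simp

lemma IsThreeToOne.exists_fiberCard {F : F2 n → F2 n} (h : IsThreeToOne F) :
    ∃ y₀, fiberCard F y₀ = 1 ∧ ∀ y, y ≠ y₀ → fiberCard F y = 0 ∨ fiberCard F y = 3 := by
  obtain ⟨y₀, h1, h3⟩ := h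
  refine ⟨y₀, by rw [← ncard_preimage_singleton, h1], fun y hy => ?_⟩
  by_cases hr : y ∈ Set.range F
  · right; rw [← ncard_preimage_singleton, h3 y hr hy]
  · left
    rw [fiberCard, Finset.card_eq_zero, Finset.filter_eq_empty_iff]
    intro x _ hx; exact hr ⟨x, hx⟩

/-- The Walsh transform at `0` of the component `v` of the translate `F + c`. -/
def charSum (F : F2 n → F2 n) (c v : F2 n) : ℤ := ∑ x, sign (v ⬝ᵥ (F x + c))

lemma charSum_eq (F : F2 n → F2 n) (c v : F2 n) :
    charSum F c v = sign (v ⬝ᵥ c) * walsh (component F v) 0 := by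
  simp only [charSum, walsh, component, dotProduct_add, sign_add, dotProduct_zero, sign_zero,
    mul_one, Finset.mul_sum]
  exact Finset.sum_congr rfl fun x _ => mul_comm _ _

lemma charSum_sq (F : F2 n → F2 n) (c v : F2 n) :
    charSum F c v ^ 2 = walsh (component F v) 0 ^ 2 := by
  rw [charSum_eq, mul_pow, sq (sign _), sign_mul_self, one_mul]

lemma charSum_zero (F : F2 n → F2 n) (c : F2 n) : charSum F c 0 = 2 ^ n := by
  simp [charSum, sign_zero]

lemma sum_charSum_mul_sign (F : F2 n → F2 n) (c d : F2 n) :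
    ∑ v, charSum F c v * sign (v ⬝ᵥ d) = 2 ^ n * fiberCard F (d + c) := by
  have h : ∀ v x : F2 n, sign (v ⬝ᵥ (F x + c)) * sign (v ⬝ᵥ d) = sign (v ⬝ᵥ (F x + (d + c))) := by
    intro v x
    simp only [dotProduct_add, sign_add]; ring
  simp_rw [charSum, Finset.sum_mul, h]
  rw [Finset.sum_comm]
  simp_rw [sum_sign_dotProduct', add_eq_zero_F2]
  rw [← Finset.sum_filter, Finset.sum_const, nsmul_eq_mul, fiberCard, mul_comm]

/-- Parseval for the fibre sizes: the right-hand sum counts the pairs (x, x') with F x = F x'. -/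
lemma sum_charSum_sq (F : F2 n → F2 n) (c : F2 n) :
    ∑ v, charSum F c v ^ 2 = 2 ^ n * ∑ x, (fiberCard F (F x) : ℤ) := by
  have h : ∀ v, charSum F c v ^ 2 = ∑ x, charSum F c v * sign (v ⬝ᵥ (F x + c)) := by
    intro v
    rw [← Finset.mul_sum, sq, charSum]
  simp_rw [h]
  rw [Finset.sum_comm, Finset.mul_sum]
  refine Finset.sum_congr rfl fun x _ => ?_
  rw [sum_charSum_mul_sign, add_assoc, add_self_F2, add_zero]

section ThreeToOne

variable {F : F2 n → F2 n} {y₀ : F2 n}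

lemma sum_fiberCard_apply (h1 : fiberCard F y₀ = 1)
    (h3 : ∀ y, y ≠ y₀ → fiberCard F y = 0 ∨ fiberCard F y = 3) :
    ∑ x, (fiberCard F (F x) : ℤ) = 3 * 2 ^ n - 2 := by
  have h : ∀ x, (fiberCard F (F x) : ℤ) = 3 - 2 * (if F x = y₀ then 1 else 0) := by
    intro x
    split_ifs with hx
    · rw [hx, h1]; rfl
    · rcases h3 _ hx with h | h
      · rw [fiberCard, Finset.card_eq_zero, Finset.filter_eq_empty_iff] at h
        exact absurd rfl (h (Finset.mem_univ x))
      · rw [h]; rfl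
  simp_rw [h]
  rw [Finset.sum_sub_distrib, ← Finset.mul_sum, Finset.sum_boole]
  change _ - 2 * ((fiberCard F y₀ : ℕ) : ℤ) = _
  rw [h1]
  simp [mul_comm]

/-- Grouped by fibres, every term is a multiple of 3 except that of y₀, which the translation by y₀
normalises to 1. -/
lemma three_dvd_charSum_sub_one (h1 : fiberCard F y₀ = 1)
    (h3 : ∀ y, y ≠ y₀ → fiberCard F y = 0 ∨ fiberCard F y = 3) (v : F2 n) :
    (3 : ℤ) ∣ charSum F y₀ v - 1 := by
  have h : charSum F y₀ v = ∑ y, (fiberCard F y : ℤ) * sign (v ⬝ᵥ (y + y₀)) := by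
    rw [charSum, ← Finset.sum_fiberwise (s := univ) (g := F)]
    refine Finset.sum_congr rfl fun y _ => ?_
    rw [fiberCard, ← nsmul_eq_mul, ← Finset.sum_const]
    refine Finset.sum_congr rfl fun x hx => ?_
    rw [(Finset.mem_filter.1 hx).2]
  rw [h, ← Finset.add_sum_erase _ _ (Finset.mem_univ y₀), h1, add_self_F2, dotProduct_zero,
    sign_zero]
  have : (3 : ℤ) ∣ ∑ y ∈ univ.erase y₀, (fiberCard F y : ℤ) * sign (v ⬝ᵥ (y + y₀)) := by
    refine Finset.dvd_sum fun y hy => ?_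
    rcases h3 y (Finset.ne_of_mem_erase hy) with h | h <;> rw [h]
    · simp
    · exact dvd_mul_right _ _
  omega

end ThreeToOne

/-! ### The two possible character sums. -/

lemma neg_two_pow_mul_self (m : ℕ) : ((-2) ^ m * (-2) ^ m : ℤ) = 2 ^ (m + m) := by
  rw [← pow_add, Even.neg_pow ⟨m, rfl⟩]

section Spectrum

variable {F : F2 (m + m) → F2 (m + m)} {y₀ : F2 (m + m)}

lemma walsh_component_zero_ne_zero (h1 : fiberCard F y₀ = 1)
    (h3 : ∀ y, y ≠ y₀ → fiberCard F y = 0 ∨ fiberCard F y = 3) (v : F2 (m + m)) :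
    walsh (component F v) 0 ≠ 0 := by
  intro h
  have := three_dvd_charSum_sub_one h1 h3 v
  rw [charSum_eq, h] at this
  omega

/-- The base -2 is chosen because (-2)^m ≡ 1 mod 3, which gives t ≡ 1 mod 3. Excluding -1 and 0 is
exactly what (t - 1)(t + 2) ≥ 0 needs. -/
lemma exists_charSum_eq_mul (hF : IsPlateaued F) (h1 : fiberCard F y₀ = 1)
    (h3 : ∀ y, y ≠ y₀ → fiberCard F y = 0 ∨ fiberCard F y = 3) (v : F2 (m + m)) :
    ∃ t : ℤ, charSum F y₀ v = (-2) ^ m * t ∧ t ≠ -1 ∧ t ≠ 0 := by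
  have hd : ((-2) ^ m : ℤ) ∣ charSum F y₀ v := by
    have : ((-2) ^ m : ℤ) ∣ 2 ^ m := by
      rw [neg_pow]
      rcases neg_one_pow_eq_or ℤ m with h | h <;> rw [h] <;> simp
    rw [charSum_eq]
    exact this.trans ((hF v).two_pow_dvd_walsh_zero (walsh_component_zero_ne_zero h1 h3 v)
      |>.mul_left _)
  obtain ⟨t, ht⟩ := hd
  have h3d := three_dvd_charSum_sub_one h1 h3 v
  have hs : (3 : ℤ) ∣ (-2) ^ m - 1 := by
    simpa using sub_dvd_pow_sub_pow (-2 : ℤ) 1 m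
  refine ⟨t, ht, ?_, ?_⟩
  · rintro rfl
    omega
  · rintro rfl
    omega

/-- The Walsh values at `0` of the components of a plateaued 3-to-1 function. -/
lemma charSum_eq_or (hF : IsPlateaued F) (h1 : fiberCard F y₀ = 1)
    (h3 : ∀ y, y ≠ y₀ → fiberCard F y = 0 ∨ fiberCard F y = 3) {v : F2 (m + m)} (hv : v ≠ 0) :
    charSum F y₀ v = (-2) ^ m ∨ charSum F y₀ v = -2 * (-2) ^ m := by
  set s : ℤ := (-2) ^ m with hs
  have hss : s * s = 2 ^ (m + m) := neg_two_pow_mul_self m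
  set A := charSum F y₀ with hA
  have hnn : ∀ w, 0 ≤ (A w - s) * (A w + 2 * s) := by
    intro w
    obtain ⟨t, ht, ht1, ht0⟩ := exists_charSum_eq_mul hF h1 h3 w
    have : (A w - s) * (A w + 2 * s) = (s * s) * ((t - 1) * (t + 2)) := by
      rw [hA, ht]; ring
    rw [this]
    refine mul_nonneg (mul_self_nonneg s) ?_
    rcases lt_or_ge t 0 with h | h
    · exact mul_nonneg_of_nonpos_of_nonpos (by omega) (by omega)
    · exact mul_nonneg (by omega) (by omega)
  have hsum1 : ∑ w, A w = 2 ^ (m + m) := by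
    have := sum_charSum_mul_sign F y₀ 0
    simpa [sign_zero, h1] using this
  have hsum2 : ∑ w, A w ^ 2 = 2 ^ (m + m) * (3 * 2 ^ (m + m) - 2) := by
    rw [hA, sum_charSum_sq, sum_fiberCard_apply h1 h3]
  -- The moments make the whole sum equal to its term at 0, so the remaining nonnegative terms all
  -- vanish.
  have htot : ∑ w, (A w - s) * (A w + 2 * s) = (A 0 - s) * (A 0 + 2 * s) := by
    have : ∀ w, (A w - s) * (A w + 2 * s) = A w ^ 2 + s * A w - 2 * (s * s) := by
      intro w; ring
    simp_rw [this]
    rw [Finset.sum_sub_distrib, Finset.sum_add_distrib, ← Finset.mul_sum, hsum1, hsum2,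
      Finset.sum_const, Finset.card_univ, card_F2, hss, hA, charSum_zero, nsmul_eq_mul]
    push_cast
    ring
  rw [← Finset.add_sum_erase _ _ (Finset.mem_univ 0), add_eq_left,
    Finset.sum_eq_zero_iff_of_nonneg fun w _ => hnn w] at htot
  rcases mul_eq_zero.1 (htot v (Finset.mem_erase.2 ⟨hv, Finset.mem_univ _⟩)) with h | h
  · left; linarith
  · right; linarith

/-! ### Sums of three graph points and the Sidon property. -/

/-- The number of ways to write `(a, b)` as an ordered sum of three points of the graph. -/
lemma card_triples (hF : IsPlateaued F) (h1 : fiberCard F y₀ = 1)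
    (h3 : ∀ y, y ≠ y₀ → fiberCard F y = 0 ∨ fiberCard F y = 3) (a b : F2 (m + m)) :
    (#{q : F2 (m + m) × F2 (m + m) | F q.1 + F q.2 + F (q.1 + q.2 + a) = b} : ℤ)
      = 2 ^ (m + m) - 2 + (-2) ^ m + (if b = F a then 2 * 2 ^ (m + m) else 0)
        - (-2) ^ m * fiberCard F (b + F a + y₀) := by
  set s : ℤ := (-2) ^ m with hs
  have hss : s * s = 2 ^ (m + m) := neg_two_pow_mul_self m
  set A := charSum F y₀ with hA
  set c := b + F a with hc
  have hv : ∀ v, ∑ q : F2 (m + m) × F2 (m + m),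
      sign (v ⬝ᵥ (F q.1 + F q.2 + F (q.1 + q.2 + a) + b)) = A v ^ 2 * sign (v ⬝ᵥ c) := by
    intro v
    have := (hF v).sum_sign_triple (walsh_component_zero_ne_zero h1 h3 v) a
    have hr : A v ^ 2 * sign (v ⬝ᵥ c)
        = walsh (component F v) 0 ^ 2 * sign (component F v a) * sign (v ⬝ᵥ b) := by
      rw [hA, charSum_sq, hc, dotProduct_add, sign_add, component]; ring
    rw [hr, ← this, ← Fintype.sum_prod_type'
      (f := fun x y => sign (component F v x + component F v y + component F v (x + y + a))),
      Finset.sum_mul]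
    refine Finset.sum_congr rfl fun q _ => ?_
    simp only [component, dotProduct_add, sign_add]
  have hcount : ∑ v, A v ^ 2 * sign (v ⬝ᵥ c) = 2 ^ (m + m) *
      (#{q : F2 (m + m) × F2 (m + m) | F q.1 + F q.2 + F (q.1 + q.2 + a) = b} : ℤ) := by
    simp_rw [← hv]
    rw [Finset.sum_comm]
    simp_rw [sum_sign_dotProduct', add_eq_zero_F2]
    rw [← Finset.sum_filter, Finset.sum_const, nsmul_eq_mul, mul_comm]
  have hA0 : A 0 = 2 ^ (m + m) := charSum_zero F y₀
  -- Both values s and -2s are roots of X² + sX - 2s², so squares become linear in A; v = 0 needs a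
  -- correction.
  have hsq : ∀ v, A v ^ 2 * sign (v ⬝ᵥ c)
      = (2 * (s * s) * sign (v ⬝ᵥ c) - s * (A v * sign (v ⬝ᵥ c)))
        + if v = 0 then A 0 ^ 2 - 2 * (s * s) + s * A 0 else 0 := by
    intro v
    split_ifs with h
    · subst h; rw [zero_dotProduct, sign_zero]; ring
    · rcases charSum_eq_or hF h1 h3 h with h' | h' <;> rw [hA, h'] <;> ring
  simp_rw [hsq] at hcount
  rw [Finset.sum_add_distrib, Finset.sum_sub_distrib, ← Finset.mul_sum, ← Finset.mul_sum,
    sum_charSum_mul_sign, sum_sign_dotProduct', Finset.sum_ite_eq' univ, if_pos (Finset.mem_univ _),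
    hss, hA0, hc] at hcount
  simp only [add_eq_zero_F2] at hcount
  apply mul_left_cancel₀ (show (2 ^ (m + m) : ℤ) ≠ 0 by positivity)
  rw [← hcount]
  split_ifs <;> ring

/-- The row x = a is full and every other row contains just y = x and y = a. -/
lemma card_trivial_triples (a : F2 n) :
    (#{q : F2 n × F2 n | q.1 = q.2 ∨ q.1 = a ∨ q.2 = a} : ℤ) = 3 * 2 ^ n - 2 := by
  have h : ∀ x : F2 n, (∑ y : F2 n, if x = y ∨ x = a ∨ y = a then (1 : ℤ) else 0)
      = 2 + if x = a then (2 ^ n - 2 : ℤ) else 0 := by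
    intro x
    rw [Finset.sum_boole]
    split_ifs with hx
    · subst hx
      simp
    · have : ({y | x = y ∨ x = a ∨ y = a} : Finset (F2 n)) = {x, a} := by
        ext y; simp [hx, eq_comm]
      rw [this, Finset.card_pair hx]; rfl
  rw [Finset.natCast_card_filter, Fintype.sum_prod_type]
  simp_rw [h]
  rw [Finset.sum_add_distrib, Finset.sum_ite_eq' univ, if_pos (Finset.mem_univ _),
    Finset.sum_const, Finset.card_univ, card_F2, nsmul_eq_mul]
  push_cast; ring

/-- The graph of a plateaued 3-to-1 function is a Sidon set. -/
lemma eq_or_eq_of_sum_eq (hF : IsPlateaued F) (h1 : fiberCard F y₀ = 1)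
    (h3 : ∀ y, y ≠ y₀ → fiberCard F y = 0 ∨ fiberCard F y = 3) {x y a : F2 (m + m)}
    (h : F x + F y + F (x + y + a) = F a) : x = y ∨ x = a ∨ y = a := by
  have hsub : ({q | q.1 = q.2 ∨ q.1 = a ∨ q.2 = a} : Finset (F2 (m + m) × F2 (m + m))) ⊆
      ({q | F q.1 + F q.2 + F (q.1 + q.2 + a) = F a} : Finset (F2 (m + m) × F2 (m + m))) := by
    rintro ⟨x, y⟩ hq
    simp only [Finset.mem_filter, Finset.mem_univ, true_and] at hq ⊢
    rcases hq with rfl | rfl | rfl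
    · rw [add_self_F2, add_self_F2, zero_add, zero_add]
    · rw [add_right_comm x y, add_self_F2, zero_add, add_assoc, add_self_F2, add_zero]
    · rw [add_assoc x, add_self_F2, add_zero, add_right_comm, add_self_F2, zero_add]
  have hcard := card_triples hF h1 h3 a (F a)
  rw [if_pos rfl, add_self_F2, zero_add, h1] at hcard
  have htriv := card_trivial_triples a
  -- With fibre size 1 the terms in s cancel, leaving exactly the number of trivial solutions.
  have heq := Finset.eq_of_subset_of_card_le hsub (by
    have : (#{q : F2 (m + m) × F2 (m + m) | F q.1 + F q.2 + F (q.1 + q.2 + a) = F a} : ℤ)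
      = #{q : F2 (m + m) × F2 (m + m) | q.1 = q.2 ∨ q.1 = a ∨ q.2 = a} := by
      rw [hcard, htriv]; push_cast; ring
    exact_mod_cast this.le)
  have hmem : (x, y) ∈ ({q | F q.1 + F q.2 + F (q.1 + q.2 + a) = F a} :
      Finset (F2 (m + m) × F2 (m + m))) := by simpa using h
  rw [← heq] at hmem
  simpa using hmem

end Spectrum

/-! ### Ordered triples versus 3-element subsets. -/

lemma card_ordered_pairs {α : Type*} [DecidableEq α] {x y z : α} (hxy : x ≠ y) (hxz : x ≠ z)
    (hyz : y ≠ z) :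
    #({(x, y), (x, z), (y, x), (y, z), (z, x), (z, y)} : Finset (α × α)) = 6 := by
  simp [Finset.card_insert_of_notMem, hxy, hxz, hyz, hxy.symm, hxz.symm, hyz.symm]

lemma triple_perms {α : Type*} [DecidableEq α] (x y z : α) :
    ({x, z, y} : Finset α) = {x, y, z} ∧ ({y, x, z} : Finset α) = {x, y, z} ∧
    ({y, z, x} : Finset α) = {x, y, z} ∧ ({z, x, y} : Finset α) = {x, y, z} ∧
    ({z, y, x} : Finset α) = {x, y, z} := by
  refine ⟨?_, ?_, ?_, ?_, ?_⟩ <;> ext <;> simp only [Finset.mem_insert, Finset.mem_singleton] <;>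
    tauto

lemma mem_ordered_pairs {α : Type*} [DecidableEq α] {x y z u w t : α} (huw : u ≠ w)
    (h : ({u, w, t} : Finset α) = {x, y, z}) :
    (u, w) ∈ ({(x, y), (x, z), (y, x), (y, z), (z, x), (z, y)} : Finset (α × α)) := by
  have hu : u ∈ ({x, y, z} : Finset α) := by rw [← h]; simp
  have hw : w ∈ ({x, y, z} : Finset α) := by rw [← h]; simp
  simp only [Finset.mem_insert, Finset.mem_singleton] at hu hw
  rcases hu with rfl | rfl | rfl <;> rcases hw with rfl | rfl | rfl <;>
    first | exact absurd rfl huw | simp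

section Multiplicity

variable (F : F2 n → F2 n)

/-- The embedding of `𝔽₂ⁿ` as the graph of `F`. -/
def graphEmb : F2 n ↪ F2 n × F2 n := ⟨fun x => (x, F x), fun _ _ h => congrArg Prod.fst h⟩

lemma graphEmb_apply (x : F2 n) : graphEmb F x = (x, F x) := rfl

lemma mult_graph_eq (p : F2 n × F2 n) :
    mult (graph F) p = #{U : Finset (F2 n) | #U = 3 ∧ ∑ x ∈ U, x = p.1 ∧ ∑ x ∈ U, F x = p.2} := by
  rw [mult, ← Set.ncard_coe_finset,
    ← Set.ncard_image_of_injective _ (Finset.map_injective (graphEmb F))]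
  congr 1
  ext T
  simp only [Set.mem_ofPred_eq, Set.mem_image, Finset.coe_filter, Finset.mem_univ, true_and]
  constructor
  · rintro ⟨hc, hsub, hsum⟩
    have hT : (T.image Prod.fst).map (graphEmb F) = T := by
      ext q
      simp only [Finset.mem_map, Finset.mem_image, graphEmb_apply]
      constructor
      · rintro ⟨_, ⟨r, hr, rfl⟩, rfl⟩
        have : r.2 = F r.1 := hsub hr
        rwa [← this]
      · intro hq
        have : q.2 = F q.1 := hsub hq
        exact ⟨q.1, ⟨q, hq, rfl⟩, by rw [← this]⟩
    refine ⟨T.image Prod.fst, ⟨?_, ?_, ?_⟩, hT⟩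
    · rw [← hc, ← hT, Finset.card_map, hT]
    · rw [← hsum, Prod.fst_sum]
      conv_rhs => rw [← hT, Finset.sum_map]
      rfl
    · rw [← hsum, Prod.snd_sum]
      conv_rhs => rw [← hT, Finset.sum_map]
      rfl
  · rintro ⟨U, ⟨hc, h1, h2⟩, rfl⟩
    refine ⟨by rw [Finset.card_map, hc], ?_, ?_⟩
    · intro q hq
      obtain ⟨x, -, rfl⟩ := Finset.mem_map.1 hq
      rfl
    · rw [Finset.sum_map]
      apply Prod.ext
      · rw [Prod.fst_sum]; exact h1
      · rw [Prod.snd_sum]; exact h2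

/-- A triple of points of the graph arises from exactly six ordered triples. -/
lemma card_fiber_triple {a b : F2 n} (hdist : ∀ x y, F x + F y + F (x + y + a) = b → x ≠ y)
    {U : Finset (F2 n)} (hU : #U = 3) (hUa : ∑ x ∈ U, x = a) (hUb : ∑ x ∈ U, F x = b) :
    #{q ∈ ({q | F q.1 + F q.2 + F (q.1 + q.2 + a) = b} : Finset (F2 n × F2 n)) |
        ({q.1, q.2, q.1 + q.2 + a} : Finset (F2 n)) = U} = 6 := by
  obtain ⟨x, y, z, hxy, hxz, hyz, rfl⟩ := Finset.card_eq_three.1 hU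
  have hx : x ∉ ({y, z} : Finset (F2 n)) := by
    simp only [Finset.mem_insert, Finset.mem_singleton, not_or]; exact ⟨hxy, hxz⟩
  have hy : y ∉ ({z} : Finset (F2 n)) := by rwa [Finset.mem_singleton]
  rw [Finset.sum_insert hx, Finset.sum_insert hy, Finset.sum_singleton] at hUa hUb
  have e1 : x + y + a = z := by
    rw [← hUa, ← add_assoc x, ← add_assoc, add_self_F2, zero_add]
  have e2 : x + z + a = y := by
    rw [← e1, ← add_assoc, ← add_assoc, add_self_F2, zero_add, add_assoc, add_self_F2, add_zero]
  have e3 : y + z + a = x := by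
    rw [← e1, add_comm x y, ← add_assoc, ← add_assoc, add_self_F2, zero_add, add_assoc,
      add_self_F2, add_zero]
  rw [← card_ordered_pairs hxy hxz hyz]
  congr 1
  ext ⟨u, w⟩
  rw [Finset.mem_filter, Finset.mem_filter]
  constructor
  · rintro ⟨⟨-, hs⟩, hset⟩
    exact mem_ordered_pairs (hdist u w hs) hset
  · intro h
    obtain ⟨p1, p2, p3, p4, p5⟩ := triple_perms x y z
    have key : F u + F w + F (u + w + a) = b ∧
        ({u, w, u + w + a} : Finset (F2 n)) = {x, y, z} := by
      simp only [Finset.mem_insert, Finset.mem_singleton, Prod.mk.injEq] at h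
      obtain h | h | h | h | h | h := h <;> rw [h.1, h.2]
      · rw [e1]; exact ⟨by rw [← hUb, add_assoc], rfl⟩
      · rw [e2]; exact ⟨by rw [← hUb]; abel, p1⟩
      · rw [add_comm y x, e1]; exact ⟨by rw [← hUb]; abel, p2⟩
      · rw [e3]; exact ⟨by rw [← hUb]; abel, p3⟩
      · rw [add_comm z x, e2]; exact ⟨by rw [← hUb]; abel, p4⟩
      · rw [add_comm z y, e3]; exact ⟨by rw [← hUb]; abel, p5⟩
    exact ⟨⟨Finset.mem_univ _, key.1⟩, key.2⟩

lemma six_mul_mult_graph {p : F2 n × F2 n} (hp : p ∉ graph F) :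
    #{q : F2 n × F2 n | F q.1 + F q.2 + F (q.1 + q.2 + p.1) = p.2} = 6 * mult (graph F) p := by
  obtain ⟨a, b⟩ := p
  have hab : b ≠ F a := hp
  -- Two equal entries would cancel, leaving (a, b) on the graph.
  have hdist : ∀ x y, F x + F y + F (x + y + a) = b →
      x ≠ y ∧ x ≠ x + y + a ∧ y ≠ x + y + a := by
    intro x y h
    refine ⟨?_, ?_, ?_⟩
    · rintro rfl
      rw [add_self_F2, add_self_F2, zero_add, zero_add] at h
      exact hab h.symm
    · intro hx
      have hy : y = a := by
        rw [add_assoc, left_eq_add] at hx; exact add_eq_zero_F2.1 hx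
      rw [← hx, hy, add_right_comm, add_self_F2, zero_add] at h
      exact hab h.symm
    · intro hy
      have hx : x = a := by
        rw [add_right_comm, right_eq_add] at hy; exact add_eq_zero_F2.1 hy
      rw [← hy, hx, add_assoc, add_self_F2, add_zero] at h
      exact hab h.symm
  rw [mult_graph_eq, mul_comm, ← smul_eq_mul, ← Finset.sum_const]
  rw [Finset.card_eq_sum_card_fiberwise
    (f := fun q : F2 n × F2 n => ({q.1, q.2, q.1 + q.2 + a} : Finset (F2 n)))
    (t := {U | #U = 3 ∧ ∑ x ∈ U, x = a ∧ ∑ x ∈ U, F x = b})]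
  · refine Finset.sum_congr rfl fun U hU => ?_
    simp only [Finset.mem_filter, Finset.mem_univ, true_and] at hU
    exact card_fiber_triple F (fun x y h => (hdist x y h).1) hU.1 hU.2.1 hU.2.2
  · rintro ⟨x, y⟩ h
    simp only [Finset.coe_filter, Finset.mem_univ, true_and, Set.mem_ofPred_eq] at h ⊢
    obtain ⟨h1, h2, h3⟩ := hdist x y h
    have hx : x ∉ ({y, x + y + a} : Finset (F2 n)) := by
      simp only [Finset.mem_insert, Finset.mem_singleton, not_or]; exact ⟨h1, h2⟩
    have hy : y ∉ ({x + y + a} : Finset (F2 n)) := by rwa [Finset.mem_singleton]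
    refine ⟨Finset.card_eq_three.2 ⟨_, _, _, h1, h2, h3, rfl⟩, ?_, ?_⟩
    · rw [Finset.sum_insert hx, Finset.sum_insert hy, Finset.sum_singleton, ← add_assoc,
        ← add_assoc, add_self_F2, zero_add]
    · rw [Finset.sum_insert hx, Finset.sum_insert hy, Finset.sum_singleton, ← add_assoc, h]

end Multiplicity

/-! ### Derivatives of F and the Walsh transform of γ. -/

/-- The number of solutions of `F x + F (x + a) = b`. -/
def derivCard (F : F2 n → F2 n) (p : F2 n × F2 n) : ℕ := #{x | F x + F (x + p.1) = p.2}

lemma delta_graph_eq (F : F2 n → F2 n) (p : F2 n × F2 n) :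
    delta (graph F) p = derivCard F p := by
  rw [delta, derivCard, ← Set.ncard_coe_finset,
    ← Set.ncard_image_of_injective _ (graphEmb F).injective]
  congr 1
  ext ⟨x, y⟩
  simp only [Set.mem_inter_iff, Set.mem_image, Finset.coe_filter, Finset.mem_univ, true_and,
    Set.mem_ofPred_eq, graphEmb_apply, graph, Prod.mk.injEq]
  constructor
  · rintro ⟨rfl, ⟨u, w⟩, hw, h⟩
    simp only at hw
    subst hw
    obtain ⟨a, b⟩ := p
    simp only [Prod.mk_add_mk, Prod.mk.injEq] at h
    obtain ⟨rfl, h2⟩ := h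
    refine ⟨a + u, ?_, rfl, rfl⟩
    simp only
    rw [add_right_comm, add_self_F2, zero_add, ← h2, add_assoc, add_self_F2, add_zero]
  · rintro ⟨u, hu, rfl, rfl⟩
    refine ⟨rfl, (u + p.1, F (u + p.1)), rfl, ?_⟩
    apply Prod.ext
    · simp only [Prod.fst_add]
      rw [add_comm u, ← add_assoc, add_self_F2, zero_add]
    · simp only [Prod.snd_add]
      rw [← hu, add_assoc, add_self_F2, add_zero]

lemma derivCard_zero (F : F2 n → F2 n) : derivCard F 0 = 2 ^ n := by
  simp [derivCard, add_self_F2]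

lemma sign_gamma_zero (F : F2 n → F2 n) : sign (gamma F 0) = 1 := by
  simp [gamma, gammaSet, sign_zero]

/-- If the graph of `F` is a Sidon set, then `δ` takes the values `0` and `2` off zero, so that it
is determined by `γ`. -/
lemma derivCard_eq {F : F2 n → F2 n}
    (hS : ∀ x y a, F x + F y + F (x + y + a) = F a → x = y ∨ x = a ∨ y = a)
    (p : F2 n × F2 n) :
    (derivCard F p : ℤ) = 1 - sign (gamma F p) + if p = 0 then 2 ^ n else 0 := by
  split_ifs with hp
  · subst hp
    rw [derivCard_zero, sign_gamma_zero]; push_cast; ring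
  · rcases Nat.eq_zero_or_pos (derivCard F p) with h | h
    · simp [gamma, gammaSet, delta_graph_eq, h, sign_zero]
    · have hγ : gamma F p = 1 := by simp [gamma, gammaSet, delta_graph_eq, h, hp]
      have h2 : derivCard F p = 2 := by
        obtain ⟨x, hx⟩ := Finset.card_pos.1 h
        obtain ⟨a, b⟩ := p
        simp only [Finset.mem_filter, Finset.mem_univ, true_and] at hx
        have ha : a ≠ 0 := by
          rintro rfl
          rw [add_zero, add_self_F2] at hx
          exact hp (by rw [← hx]; rfl)
        have hset : ({z | F z + F (z + a) = b} : Finset (F2 n)) = {x, x + a} := by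
          ext z
          simp only [Finset.mem_filter, Finset.mem_univ, true_and, Finset.mem_insert,
            Finset.mem_singleton]
          constructor
          · intro hz
            have e : x + z + (z + a) = x + a := by
              rw [← add_assoc, add_assoc x, add_self_F2, add_zero]
            -- For two solutions x and z, the graph points over x, z and x + a sum to the one over z
            -- + a.
            have := hS x z (z + a) (by
              rw [e, add_right_comm, hx, ← hz, add_right_comm, add_self_F2, zero_add])
            rcases this with h | h | h
            · exact Or.inl h.symm
            · right; exact (add_eq_iff_F2.2 h).symm
            · exact absurd (left_eq_add.1 h) ha
          · rintro (rfl | rfl)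
            · exact hx
            · rw [add_assoc, add_self_F2, add_zero, add_comm, hx]
        rw [derivCard]
        change #({z | F z + F (z + a) = b} : Finset (F2 n)) = 2
        rw [hset, Finset.card_pair]
        exact fun h => ha (left_eq_add.1 h)
      rw [h2, hγ, sign_one]; rfl

/-- The pairing of `(𝔽₂ⁿ)²` with itself, as a sign. -/
def chi (w p : F2 n × F2 n) : ℤ := sign (p.1 ⬝ᵥ w.1) * sign (w.2 ⬝ᵥ p.2)

lemma chi_add (w p q : F2 n × F2 n) : chi w (p + q) = chi w p * chi w q := by
  simp only [chi, Prod.fst_add, Prod.snd_add, add_dotProduct, dotProduct_add, sign_add]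
  ring

lemma chi_zero (w : F2 n × F2 n) : chi w 0 = 1 := by
  simp [chi, sign_zero]

lemma sum_chi (w : F2 n × F2 n) : ∑ p, chi w p = if w = 0 then 2 ^ n * 2 ^ n else 0 := by
  obtain ⟨u, v⟩ := w
  simp only [chi]
  rw [Fintype.sum_prod_type' (f := fun a b : F2 n => sign (a ⬝ᵥ u) * sign (v ⬝ᵥ b)),
    ← Finset.sum_mul_sum, sum_sign_dotProduct, sum_sign_dotProduct']
  simp only [Prod.mk_eq_zero]
  split_ifs <;> simp_all

lemma sum_derivCard_mul_chi (F : F2 n → F2 n) (w : F2 n × F2 n) :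
    ∑ p, (derivCard F p : ℤ) * chi w p = walsh (component F w.2) w.1 ^ 2 := by
  obtain ⟨u, v⟩ := w
  have h : ∀ p : F2 n × F2 n, (derivCard F p : ℤ) * chi (u, v) p
      = ∑ x, if F x + F (x + p.1) = p.2 then chi (u, v) p else 0 := by
    intro p
    rw [← Finset.sum_filter, Finset.sum_const, nsmul_eq_mul, derivCard]
  simp_rw [h]
  rw [Finset.sum_comm, sq]
  nth_rw 1 [walsh]
  rw [Finset.sum_mul]
  refine Finset.sum_congr rfl fun x _ => ?_
  -- The substitution y = x + a matches the second Walsh factor with the derivative in direction a.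
  rw [Fintype.sum_prod_type, walsh, Finset.mul_sum,
    ← Equiv.sum_comp (Equiv.addLeft x) fun y => _ * sign (component F v y + y ⬝ᵥ u)]
  refine Finset.sum_congr rfl fun a _ => ?_
  dsimp only
  rw [Finset.sum_ite_eq univ, if_pos (Finset.mem_univ _)]
  simp only [chi, component, Equiv.coe_addLeft, dotProduct_add, add_dotProduct, sign_add]
  linear_combination (-(sign (a ⬝ᵥ u) * sign (v ⬝ᵥ F x) * sign (v ⬝ᵥ F (x + a)))) *
    sign_mul_self (x ⬝ᵥ u)

/-- The Walsh transform of `γ`. -/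
lemma sum_sign_gamma_mul_chi {F : F2 n → F2 n}
    (hS : ∀ x y a, F x + F y + F (x + y + a) = F a → x = y ∨ x = a ∨ y = a)
    (w : F2 n × F2 n) :
    ∑ p, sign (gamma F p) * chi w p
      = (if w = 0 then 2 ^ n * 2 ^ n else 0) + 2 ^ n - walsh (component F w.2) w.1 ^ 2 := by
  have h : ∀ p, sign (gamma F p) * chi w p
      = chi w p + (if p = 0 then 2 ^ n * chi w p else 0) - derivCard F p * chi w p := by
    intro p
    rw [derivCard_eq hS]
    split_ifs <;> ring
  simp_rw [h]
  rw [Finset.sum_sub_distrib, Finset.sum_add_distrib, sum_chi, sum_derivCard_mul_chi,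
    Finset.sum_ite_eq' univ, if_pos (Finset.mem_univ _), chi_zero, mul_one]

/-- A linear structure constrains the support of the Walsh transform. -/
lemma IsLinearStructure.sign_mul_chi_eq_one {f : F2 n × F2 n → ZMod 2} {ε : ZMod 2}
    {p : F2 n × F2 n} (h : IsLinearStructure f ε p) {w : F2 n × F2 n}
    (hw : ∑ x, sign (f x) * chi w x ≠ 0) : sign ε * chi w p = 1 := by
  -- Translation by p preserves the sum but multiplies it by `sign ε * chi w p`.
  have hs := Equiv.sum_comp (Equiv.addRight p) fun x => sign (f x) * chi w x
  have hf : ∀ x, sign (f (x + p)) * chi w (x + p)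
      = (sign ε * chi w p) * (sign (f x) * chi w x) := by
    intro x
    rw [chi_add, ← h.2 x, sign_add]
    linear_combination (-(sign (f (x + p)) * chi w x * chi w p)) * sign_mul_self (f x)
  simp only [Equiv.coe_addRight, hf] at hs
  rw [← Finset.mul_sum] at hs
  exact mul_right_cancel₀ hw (by rw [hs, one_mul])

/-! ### Linear structures and exclude multiplicities. -/

lemma walsh_component_zero (F : F2 n → F2 n) (u : F2 n) :
    walsh (component F 0) u = if u = 0 then 2 ^ n else 0 := by
  simp only [walsh, component, zero_dotProduct, zero_add]
  exact sum_sign_dotProduct' u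

section ThreeToOne

variable {F : F2 (m + m) → F2 (m + m)} {y₀ : F2 (m + m)}

lemma not_isLinearStructure_gamma (hm : 2 ≤ m) (hF : IsPlateaued F) (h1 : fiberCard F y₀ = 1)
    (h3 : ∀ y, y ≠ y₀ → fiberCard F y = 0 ∨ fiberCard F y = 3) (ε : ZMod 2)
    (p : F2 (m + m) × F2 (m + m)) : ¬ IsLinearStructure (gamma F) ε p := by
  intro h
  obtain ⟨a, b⟩ := p
  have hpos : (0 : ℤ) < 2 ^ (m + m) := by positivity
  have hG := sum_sign_gamma_mul_chi fun x y a => eq_or_eq_of_sum_eq (x := x) (y := y) (a := a)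
    hF h1 h3
  have hε : sign ε = 1 := by
    have := h.sign_mul_chi_eq_one (w := 0) (by
      rw [hG, if_pos rfl, Prod.snd_zero, Prod.fst_zero, walsh_component_zero, if_pos rfl]
      ring_nf; positivity)
    simpa [chi, sign_zero] using this
  -- At (u, 0) with u ≠ 0 the transform of γ is 2^n ≠ 0, so a is orthogonal to every u.
  have ha : a = 0 := by
    by_contra ha
    obtain ⟨u, hu⟩ := exists_dotProduct_eq_one ha
    have hu0 : u ≠ 0 := by
      rintro rfl
      rw [dotProduct_zero] at hu
      exact zero_ne_one hu
    have := h.sign_mul_chi_eq_one (w := (u, 0)) (by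
      rw [hG, walsh_component_zero, if_neg hu0, if_neg (by simp [hu0])]
      simp)
    simp [chi, hε, hu, sign_one, sign_zero] at this
  have hss := neg_two_pow_mul_self m
  set s : ℤ := (-2) ^ m with hs
  -- If A(v) = -2s, the transform of γ at (0, v) is 2^n - 4·2^n ≠ 0, forcing v·b = 0.
  have hv : ∀ v, (charSum F y₀ v - s) * (sign (v ⬝ᵥ b) - 1) = 0 := by
    intro v
    by_cases hv0 : v = 0
    · subst hv0; rw [zero_dotProduct, sign_zero]; ring
    rcases charSum_eq_or hF h1 h3 hv0 with hA | hA
    · rw [hA, sub_self, zero_mul]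
    · have := h.sign_mul_chi_eq_one (w := (0, v)) (by
        rw [hG, if_neg (by simp [hv0])]
        simp only
        rw [← charSum_sq F y₀, hA, mul_pow, sq ((-2) ^ m), ← hs, hss]
        linarith)
      simp only [chi, hε, dotProduct_zero, sign_zero, one_mul] at this
      rw [this]; ring
  have hb : b ≠ 0 := fun hb => h.1 (by rw [ha, hb]; rfl)
  have hsum := Finset.sum_eq_zero fun v (_ : v ∈ (univ : Finset (F2 (m + m)))) => hv v
  -- Writing 1 as the character at 0 makes each sum an inversion formula, at b or at 0.
  have hexp : ∀ v, (charSum F y₀ v - s) * (sign (v ⬝ᵥ b) - 1)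
      = charSum F y₀ v * sign (v ⬝ᵥ b) - charSum F y₀ v * sign (v ⬝ᵥ (0 : F2 (m + m)))
        - s * sign (v ⬝ᵥ b) + s * sign (v ⬝ᵥ (0 : F2 (m + m))) := by
    intro v
    rw [dotProduct_zero, sign_zero]; ring
  simp_rw [hexp] at hsum
  rw [Finset.sum_add_distrib, Finset.sum_sub_distrib, Finset.sum_sub_distrib, ← Finset.mul_sum,
    ← Finset.mul_sum, sum_charSum_mul_sign, sum_charSum_mul_sign, sum_sign_dotProduct',
    sum_sign_dotProduct', if_neg hb, if_pos rfl, zero_add, h1] at hsum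
  have hfin : (fiberCard F (b + y₀) : ℤ) - 1 + s = 0 :=
    mul_left_cancel₀ hpos.ne' (by linear_combination hsum)
  have h4 : (4 : ℤ) ∣ s := by
    have := pow_dvd_pow (-2 : ℤ) hm
    simpa using this
  -- Fibre sizes 0 and 3 would need s = 1 or s = -2; the latter does occur for m = 1.
  rcases h3 (b + y₀) (by simpa using hb) with h | h <;> rw [h] at hfin <;> omega

lemma mult_graph_eq_alpha_or_beta (hF : IsPlateaued F) (h1 : fiberCard F y₀ = 1)
    (h3 : ∀ y, y ≠ y₀ → fiberCard F y = 0 ∨ fiberCard F y = 3)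
    {p : F2 (m + m) × F2 (m + m)} (hp : p ∉ graph F) :
    (mult (graph F) p : ℚ) = alpha (m + m) ∨ (mult (graph F) p : ℚ) = beta (m + m) := by
  have hp' : p.2 ≠ F p.1 := hp
  have hc := card_triples hF h1 h3 p.1 p.2
  rw [six_mul_mult_graph F hp, if_neg hp'] at hc
  have hne : p.2 + F p.1 + y₀ ≠ y₀ := by
    rwa [Ne, add_eq_right, add_eq_zero_F2]
  have hhalf : (m + m) / 2 = m := by omega
  rw [alpha, beta, hhalf, pow_succ]
  -- Fibre size 3 replaces s by s - 3s = (-2)^(m+1).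
  rcases h3 _ hne with h | h <;> rw [h] at hc
  · right
    have : (6 * mult (graph F) p : ℚ) = 2 ^ (m + m) - 2 + (-2) ^ m := by
      exact_mod_cast (by simpa using hc :
        (6 * mult (graph F) p : ℤ) = 2 ^ (m + m) - 2 + (-2) ^ m)
    linarith
  · left
    have hc' : (6 * mult (graph F) p : ℤ) = 2 ^ (m + m) - 2 + (-2) ^ m - (-2) ^ m * 3 := by
      simpa using hc
    have : (6 * mult (graph F) p : ℚ) = 2 ^ (m + m) - 2 + (-2) ^ m - (-2) ^ m * 3 := by
      exact_mod_cast hc'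
    linarith

end ThreeToOne

/-- Since (2^n - 1)/3 = (2·2^n - 2)/6, both strict bounds reduce to this inequality, with k = m + 1
for α and k = m for β. -/
lemma neg_two_pow_lt (hm : 2 ≤ m) {k : ℕ} (hk : k ≤ m + 1) : ((-2) ^ k : ℚ) < 2 ^ (m + m) := by
  calc ((-2) ^ k : ℚ) ≤ |(-2) ^ k| := le_abs_self _
    _ = 2 ^ k := by rw [abs_pow]; norm_num
    _ < 2 ^ (m + m) := pow_lt_pow_right₀ (by norm_num) (by omega)

end VBF

theorem mainTheorem7 (n : ℕ) (hn : 4 ≤ n) (hn_even : Even n)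
    (F : VBF.F2 n → VBF.F2 n) (hplateaued : VBF.IsPlateaued F)
    (hthree : VBF.IsThreeToOne F) :
    (¬ ∃ (ε : ZMod 2) (p : VBF.F2 n × VBF.F2 n), VBF.IsLinearStructure (VBF.gamma F) ε p) ∧
    (∀ p : VBF.F2 n × VBF.F2 n, p ∉ VBF.graph F →
      (VBF.mult (VBF.graph F) p : ℚ) = VBF.alpha n ∨
      (VBF.mult (VBF.graph F) p : ℚ) = VBF.beta n) ∧
    VBF.alpha n < (2 ^ n - 1) / 3 ∧ VBF.beta n < (2 ^ n - 1) / 3 := by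
  obtain ⟨m, rfl⟩ := hn_even
  have hm : 2 ≤ m := by omega
  have hhalf : (m + m) / 2 = m := by omega
  obtain ⟨y₀, h1, h3⟩ := hthree.exists_fiberCard
  refine ⟨?_, fun p hp => VBF.mult_graph_eq_alpha_or_beta hplateaued h1 h3 hp, ?_, ?_⟩
  · rintro ⟨ε, p, h⟩
    exact VBF.not_isLinearStructure_gamma hm hplateaued h1 h3 ε p h
  · have := VBF.neg_two_pow_lt hm le_rfl
    rw [VBF.alpha, hhalf]
    linarith
  · have := VBF.neg_two_pow_lt hm m.le_succ
    rw [VBF.beta, hhalf]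
    linarith
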